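/- For integers $n\ge 1$, $k_1,\dots,k_{n-1}\ge 1$ and $k_n\ge 2$, let $$\zeta^{\star}(k_1,\dots,k_n)=\sum_{1\le m_1\le\cdots\le m_n<\infty}\frac{1}{m_1^{k_1}\cdots m_n^{k_n}},\qquad \zeta^{\star}_{-}(k_1,\dots,k_n)=\sum_{1\le m_1\le\cdots\le m_n<\infty}\frac{(-1)^{m_n-1}}{m_1^{k_1}\cdots m_n^{k_n}},$$ let $\{1\}^{a}$ denote $1,\dots,1$ ($a$ times, empty for $a=0$), and let $\binom{x}{i}=x(x-1)\cdots(x-i+1)/i!$ for integers $x$ and $i\ge0$ (so $\binom{-1}{0}=1$). Then for all integers $r\ge 0$ and $s\ge 1$ all of the series of this form occurring below converge absolutely, and $$\sum_{i=0}^{r}\left\{\binom{s-2+i}{i}+\binom{s-1+i}{i}\right\}\zeta^{\star}_{-}(\{1\}^{r-i},2s+i) =\sum_{\substack{r_1+\cdots+r_s=r\\ r_1,\dots,r_s\in\mathbb{Z}_{\ge0}}}(r_1+1)\,\zeta^{\star}(r_1+2,\dots,r_s+2).$$ -/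

import Mathlib

/-- The index set of the star sums: tuples `(m₁, …, mₙ)` of integers with `1 ≤ m₁ ≤ ⋯ ≤ mₙ`. -/
def StarIndex (n : ℕ) : Type :=
  {m : Fin n → ℕ // Monotone m ∧ ∀ j, 1 ≤ m j}

/-- The summand `z ^ (mₙ - 1) / (m₁ ^ k₁ ⋯ mₙ ^ kₙ)`; the last of the `n ≥ 1` entries of `m` has
index `n - 1` in `Fin n`, and `mₙ ≥ 1`, so both natural-number subtractions are genuine. -/
noncomputable def mplStarTerm (z : ℝ) {n : ℕ} (hn : 1 ≤ n) (k : Fin n → ℕ) (m : StarIndex n) : ℝ :=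
  z ^ (m.1 ⟨n - 1, Nat.sub_lt hn Nat.one_pos⟩ - 1) / ∏ j, (m.1 j : ℝ) ^ k j

/-- The star-type special value of a multiple polylogarithm,
`∑_{1 ≤ m₁ ≤ ⋯ ≤ mₙ < ∞} z ^ (mₙ - 1) / (m₁ ^ k₁ ⋯ mₙ ^ kₙ)`. -/
noncomputable def mplStar (z : ℝ) {n : ℕ} (hn : 1 ≤ n) (k : Fin n → ℕ) : ℝ :=
  ∑' m : StarIndex n, mplStarTerm z hn k m

/-- The multiple zeta-star value `ζ^⋆(k₁, …, kₙ)`. -/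
noncomputable def zetaStar {n : ℕ} (hn : 1 ≤ n) (k : Fin n → ℕ) : ℝ :=
  mplStar 1 hn k

/-- The alternating value `ζ₋^⋆(k₁, …, kₙ)`. -/
noncomputable def zetaStarMinus {n : ℕ} (hn : 1 ≤ n) (k : Fin n → ℕ) : ℝ :=
  mplStar (-1) hn k

/-- The index `({1}^a, b) = (1, …, 1, b)` with `a` ones. -/
def onesThen (a b : ℕ) : Fin (a + 1) → ℕ :=
  Fin.snoc (α := fun _ => ℕ) (fun _ : Fin a => 1) b

/-!
Summed against `X ^ r`, the right-hand sides truncated at `N` give the star sum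
`∑_{1 ≤ m₁ ≤ ⋯ ≤ mₛ ≤ N} m₁ / (m₁ - X) * ∏_j 1 / (m_j (m_j - X))`, written `S_{s,N}`. Its partial
fraction expansion is `∑_{m ≤ N} c_{N,m} (m (m - X))⁻ˢ` with explicit `c_{N,m}`: both sides satisfy
`S_{s,N+1} - S_{s,N} = S_{s-1,N+1} / ((N + 1) (N + 1 - X))`, and at `s = 0` the expansion
telescopes. As `N → ∞`, `c_{N,m}` tends coefficientwise to
`(-1) ^ (m + 1) (2 - X / m) ∏_{j ≤ m} j / (j - X)`. The product generates the inner sums of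
`ζ₋^⋆({1}^a, b)`, and `(2 - X / m) (m (m - X))⁻ˢ` the sums of two binomial coefficients. With `h_m`
the harmonic numbers, the coefficients of `X ^ r` are `O(h_m ^ r / m ^ 2)` uniformly in `N`, so the
limit may be taken termwise.
-/

open Asymptotics Finset Filter Topology PowerSeries

theorem monotone_snoc_iff {α : Type*} [Preorder α] {n : ℕ} {m : Fin n → α} {M : α} :
    Monotone (Fin.snoc (α := fun _ => α) m M) ↔ Monotone m ∧ ∀ j, m j ≤ M := by
  constructor
  · intro h
    refine ⟨fun i j hij => ?_, fun j => ?_⟩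
    · simpa using h (Fin.castSucc_le_castSucc_iff.2 hij)
    · simpa using h (Fin.le_last j.castSucc)
  · rintro ⟨hm, hM⟩ i j
    cases j using Fin.lastCases with
    | last => cases i using Fin.lastCases <;> simp [hM]
    | cast j =>
      cases i using Fin.lastCases with
      | last => exact fun h => absurd h (Fin.castSucc_lt_last j).not_ge
      | cast i => simpa using fun h => hm h

/-- The tuples `1 ≤ m₁ ≤ ⋯ ≤ mₙ ≤ N`, over which truncated star sums are taken. -/
def starTuples (n N : ℕ) : Finset (Fin n → ℕ) :=
  {m ∈ Fintype.piFinset fun _ => Icc 1 N | Monotone m}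

theorem mem_starTuples {n N : ℕ} {m : Fin n → ℕ} :
    m ∈ starTuples n N ↔ (∀ j, 1 ≤ m j ∧ m j ≤ N) ∧ Monotone m := by
  simp [starTuples]

theorem snoc_mem_starTuples {n N M : ℕ} {m : Fin n → ℕ} :
    (Fin.snoc m (M + 1) : Fin (n + 1) → ℕ) ∈ starTuples (n + 1) N ↔
      M < N ∧ m ∈ starTuples n (M + 1) := by
  simp only [mem_starTuples, Fin.forall_fin_succ', Fin.snoc_castSucc, Fin.snoc_last,
    monotone_snoc_iff]
  grind

theorem sum_starTuples_succ {R : Type*} [AddCommMonoid R] (n N : ℕ)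
    (f : (Fin (n + 1) → ℕ) → R) :
    ∑ m ∈ starTuples (n + 1) N, f m =
      ∑ M ∈ range N, ∑ m ∈ starTuples n (M + 1), f (Fin.snoc m (M + 1)) := by
  rw [sum_sigma']
  symm
  refine sum_bij' (fun p _ => Fin.snoc p.2 (p.1 + 1))
    (fun m _ => ⟨m (Fin.last n) - 1, Fin.init m⟩) ?_ ?_ ?_ ?_ fun _ _ => rfl
  · rintro ⟨M, m⟩ hm
    simpa [snoc_mem_starTuples] using hm
  · intro m hm
    have hpos := ((mem_starTuples.1 hm).1 (Fin.last n)).1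
    rw [← Fin.snoc_init_self m, ← Nat.sub_add_cancel hpos, snoc_mem_starTuples] at hm
    simpa using hm
  · rintro ⟨M, m⟩ _
    simp
  · intro m hm
    have hpos := ((mem_starTuples.1 hm).1 (Fin.last n)).1
    simp [Nat.sub_add_cancel hpos]

section StarSum

variable {R : Type*} [CommSemiring R] {n : ℕ}

/-- The truncated star sum `∑ f₁(m₁) ⋯ fₙ(mₙ)` over `1 ≤ m₁ ≤ ⋯ ≤ mₙ ≤ N`. -/
def starSum (f : Fin n → ℕ → R) (N : ℕ) : R :=
  ∑ m ∈ starTuples n N, ∏ j, f j (m j)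

@[simp]
theorem starSum_fin_zero (f : Fin 0 → ℕ → R) (N : ℕ) : starSum f N = 1 := by
  have : starTuples 0 N = {Fin.elim0} := by
    ext m
    simp [mem_starTuples, Subsingleton.elim m Fin.elim0, Subsingleton.monotone]
  simp [starSum, this]

theorem starSum_eq_sum_range (f : Fin (n + 1) → ℕ → R) (N : ℕ) :
    starSum f N = ∑ M ∈ range N, starSum (Fin.init f) (M + 1) * f (Fin.last n) (M + 1) := by
  simp only [starSum, sum_starTuples_succ, Fin.prod_univ_castSucc, Fin.snoc_castSucc,
    Fin.snoc_last, sum_mul, Fin.init]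

theorem starSum_add_one (f : Fin (n + 1) → ℕ → R) (N : ℕ) :
    starSum f (N + 1) =
      starSum f N + starSum (Fin.init f) (N + 1) * f (Fin.last n) (N + 1) := by
  simp only [starSum_eq_sum_range f, sum_range_succ]

theorem starSum_mul_left (c : Fin n → R) (f : Fin n → ℕ → R) (N : ℕ) :
    starSum (fun j m => c j * f j m) N = (∏ j, c j) * starSum f N := by
  simp only [starSum, prod_mul_distrib, mul_sum]

theorem coeff_prod_univ {ι : Type*} [Fintype ι] [DecidableEq ι] (f : ι → R⟦X⟧) (r : ℕ) :
    coeff r (∏ j, f j) = ∑ ρ ∈ piAntidiag univ r, ∏ j, coeff (ρ j) (f j) := by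
  rw [coeff_prod]
  exact sum_equiv Finsupp.equivFunOnFinite (by simp) (by simp)

theorem coeff_starSum (f : Fin n → ℕ → R⟦X⟧) (N r : ℕ) :
    coeff r (starSum f N) =
      ∑ ρ ∈ piAntidiag univ r, starSum (fun j m => coeff (ρ j) (f j m)) N := by
  simp only [starSum, map_sum, coeff_prod_univ]
  exact sum_comm

theorem starSum_nonneg [PartialOrder R] [IsOrderedRing R] {f : Fin n → ℕ → R}
    (hf : ∀ j m, 0 ≤ f j m) (N : ℕ) : 0 ≤ starSum f N :=
  sum_nonneg fun _ _ => prod_nonneg fun _ _ => hf _ _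

theorem starSum_le_prod_sum [PartialOrder R] [IsOrderedRing R] {f : Fin n → ℕ → R}
    (hf : ∀ j m, 0 ≤ f j m) (N : ℕ) : starSum f N ≤ ∏ j, ∑ m ∈ Icc 1 N, f j m := by
  rw [prod_univ_sum]
  exact sum_le_sum_of_subset_of_nonneg (filter_subset _ _)
    fun _ _ _ => prod_nonneg fun _ _ => hf _ _

end StarSum

section Geom

/-- The geometric series `1 / (1 - aX)`. -/
noncomputable def geom {R : Type*} [Semiring R] (a : R) : R⟦X⟧ :=
  PowerSeries.mk fun i => a ^ i

@[simp]
theorem coeff_geom {R : Type*} [Semiring R] (a : R) (i : ℕ) : coeff i (geom a) = a ^ i :=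
  coeff_mk _ _

variable {R : Type*} [CommRing R]

theorem geom_eq_rescale (a : R) : geom a = rescale a (PowerSeries.mk 1) := by
  ext i
  simp

theorem geom_mul_one_sub (a : R) : geom a * (1 - C a * X) = 1 := by
  rw [geom_eq_rescale, ← rescale_X, ← map_one (rescale a), ← map_sub, ← map_mul,
    mk_one_mul_one_sub_eq_one, map_one]

theorem coeff_geom_pow (a : R) (d i : ℕ) :
    coeff i (geom a ^ d) = d.multichoose i * a ^ i := by
  cases d with
  | zero => cases i <;> simp [coeff_one]
  | succ d =>
    rw [geom_eq_rescale, ← map_pow, mk_one_pow_eq_mk_choose_add, coeff_rescale, coeff_mk,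
      Nat.multichoose_eq, Nat.add_right_comm, Nat.add_sub_cancel, Nat.choose_symm_add, mul_comm]

theorem coeff_succ_mul_geom (p : R⟦X⟧) (a : R) (i : ℕ) :
    coeff (i + 1) (p * geom a) = coeff (i + 1) p + coeff i (p * geom a) * a := by
  have h : p * geom a = p + p * geom a * X * C a := by
    linear_combination p * geom_mul_one_sub a
  conv_lhs => rw [h, map_add, coeff_mul_C, coeff_succ_mul_X]

theorem coeff_prod_geom (x : ℕ → R) (a N : ℕ) :
    coeff a (∏ j ∈ range N, geom (x (j + 1))) = starSum (fun _ : Fin a => x) N := by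
  induction a generalizing N with
  | zero => simp [map_prod, geom]
  | succ a ih =>
    induction N with
    | zero => simp [coeff_one, starSum_eq_sum_range]
    | succ N ihN =>
      rw [starSum_add_one, prod_range_succ, coeff_succ_mul_geom, ← prod_range_succ, ihN, ih]
      rfl

end Geom

section PartialFractions

variable {K : Type*} [Field K]

/-- `1 / (m (m - X))`, the generating function of the weights `1 / m ^ (i + 2)`. -/
noncomputable def invMulSubX (K : Type*) [Field K] (m : ℕ) : K⟦X⟧ :=
  C ((m : K)⁻¹ ^ 2) * geom (m : K)⁻¹

/-- `∏_{j=1}^m j / (j - X)`, the generating function of the complete homogeneous symmetric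
polynomials in `1, 1/2, …, 1/m`. -/
noncomputable def harmonicProd (K : Type*) [Field K] (m : ℕ) : K⟦X⟧ :=
  ∏ j ∈ range m, geom ((j + 1 : ℕ) : K)⁻¹

/-- `∏_{j=1}^m (N + 1 - j) / (N + j - X)`, which vanishes for `N < m` and tends to `1` as
`N → ∞`. -/
noncomputable def ratioProd (K : Type*) [Field K] (N m : ℕ) : K⟦X⟧ :=
  ∏ j ∈ range m, C (((N : K) - j) * ((N + 1 + j : ℕ) : K)⁻¹) * geom ((N + 1 + j : ℕ) : K)⁻¹

/-- The coefficient of `(m (m - X))⁻ˢ` in the partial fraction expansion of the generating function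
of the star sums truncated at `N`. -/
noncomputable def partialFracCoeff (K : Type*) [Field K] (N m : ℕ) : K⟦X⟧ :=
  (-1) ^ (m + 1) * (2 - C (m : K)⁻¹ * X) * harmonicProd K m * ratioProd K N m

theorem ratioProd_eq_zero {N m : ℕ} (h : N < m) : ratioProd K N m = 0 :=
  prod_eq_zero (mem_range.2 h) (by simp)

/-- The limit as `N → ∞` of the `m`-th term of the partial fraction expansion. -/
noncomputable def partialFracLimit (K : Type*) [Field K] (s m : ℕ) : K⟦X⟧ :=
  (-1) ^ (m + 1) * ((2 - C (m : K)⁻¹ * X) * invMulSubX K m ^ s) * harmonicProd K m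

theorem partialFracCoeff_mul_invMulSubX_pow (s N m : ℕ) :
    partialFracCoeff K N m * invMulSubX K m ^ s =
      partialFracLimit K s m * ratioProd K N m := by
  rw [partialFracCoeff, partialFracLimit]
  ring

theorem two_sub_mul_invMulSubX_pow (s m : ℕ) :
    (2 - C (m : K)⁻¹ * X) * invMulSubX K m ^ (s + 1) =
      C ((m : K)⁻¹ ^ (2 * (s + 1))) * (geom (m : K)⁻¹ ^ s + geom (m : K)⁻¹ ^ (s + 1)) := by
  rw [invMulSubX, mul_pow, ← map_pow, ← pow_mul]
  linear_combination C ((m : K)⁻¹ ^ (2 * (s + 1))) * geom (m : K)⁻¹ ^ s *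
    geom_mul_one_sub (m : K)⁻¹

theorem coeff_harmonicProd (a m : ℕ) :
    coeff a (harmonicProd K m) = starSum (fun (_ : Fin a) j => (j : K)⁻¹) m :=
  coeff_prod_geom (fun j => (j : K)⁻¹) a m

theorem coeff_partialFracLimit (s m r : ℕ) :
    coeff r (partialFracLimit K (s + 1) m) =
      ∑ i ∈ range (r + 1), ((s.multichoose i : K) + (s + 1).multichoose i) *
        ((-1) ^ (m + 1) * (starSum (fun (_ : Fin (r - i)) j => (j : K)⁻¹) m *
          (m : K)⁻¹ ^ (2 * (s + 1) + i))) := by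
  have hsign : ((-1) ^ (m + 1) : K⟦X⟧) = C ((-1) ^ (m + 1)) := by simp
  rw [partialFracLimit, two_sub_mul_invMulSubX_pow, hsign, mul_assoc, coeff_C_mul, coeff_mul,
    Finset.Nat.sum_antidiagonal_eq_sum_range_succ_mk, mul_sum]
  refine sum_congr rfl fun i _ => ?_
  rw [coeff_C_mul, map_add, coeff_geom_pow, coeff_geom_pow, coeff_harmonicProd]
  ring

variable [CharZero K]

theorem natCast_mul_C_inv {m : ℕ} (hm : m ≠ 0) : (m : K⟦X⟧) * C (m : K)⁻¹ = 1 := by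
  rw [← map_natCast (C : K →+* K⟦X⟧), ← map_mul, mul_inv_cancel₀ (Nat.cast_ne_zero.2 hm), map_one]

theorem natCast_sub_X_mul_geom {m : ℕ} (hm : m ≠ 0) :
    (m - (X : K⟦X⟧)) * geom (m : K)⁻¹ = m := by
  linear_combination m * geom_mul_one_sub (m : K)⁻¹ +
    X * geom (m : K)⁻¹ * natCast_mul_C_inv (K := K) hm

theorem natCast_sub_X_ne_zero {m : ℕ} (hm : m ≠ 0) : m - (X : K⟦X⟧) ≠ 0 := fun h =>
  hm <| by simpa using congrArg constantCoeff h

theorem mul_sub_X_mul_invMulSubX {m : ℕ} (hm : m ≠ 0) :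
    (m : K⟦X⟧) * (m - (X : K⟦X⟧)) * invMulSubX K m = 1 := by
  have h := natCast_mul_C_inv (K := K) hm
  rw [invMulSubX, map_pow]
  linear_combination (m : K⟦X⟧) * C (m : K)⁻¹ ^ 2 * natCast_sub_X_mul_geom (K := K) hm +
    (m * C (m : K)⁻¹ + 1) * h

theorem harmonicProd_succ (m : ℕ) :
    (m + 1 - (X : K⟦X⟧)) * harmonicProd K (m + 1) = (m + 1) * harmonicProd K m := by
  have h := natCast_sub_X_mul_geom (K := K) m.succ_ne_zero
  rw [harmonicProd, prod_range_succ, ← harmonicProd]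
  push_cast at h ⊢
  linear_combination harmonicProd K m * h

theorem ratioProd_succ (N m : ℕ) :
    (N + 1 + m - (X : K⟦X⟧)) * ratioProd K N (m + 1) = (N - m) * ratioProd K N m := by
  have hne : N + 1 + m ≠ 0 := by omega
  have h := natCast_sub_X_mul_geom (K := K) hne
  have hinv := natCast_mul_C_inv (K := K) hne
  rw [ratioProd, prod_range_succ, ← ratioProd]
  simp only [map_mul, map_sub, map_natCast]
  push_cast at h hinv ⊢
  linear_combination ratioProd K N m * (N - m) *
    (C ((N : K) + 1 + m)⁻¹ * h + hinv)

theorem ratioProd_add_one_left (N m : ℕ) :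
    ((N : K⟦X⟧) + 1) * (N + 1 - (X : K⟦X⟧)) * ratioProd K N m =
      (N + 1 - m) * (N + 1 + m - (X : K⟦X⟧)) * ratioProd K (N + 1) m := by
  induction m with
  | zero => simp [ratioProd]
  | succ m ih =>
    have hne := natCast_sub_X_ne_zero (K := K) (m := N + 1 + m) (by omega)
    have h₁ := ratioProd_succ (K := K) N m
    have h₂ := ratioProd_succ (K := K) (N + 1) m
    refine mul_left_cancel₀ hne ?_
    push_cast at h₂ ⊢
    linear_combination ((N : K⟦X⟧) + 1) * (N + 1 - (X : K⟦X⟧)) * h₁ + ((N : K⟦X⟧) - m) * ih -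
      (N + 1 + m - (X : K⟦X⟧)) * (N - m) * h₂

theorem partialFracCoeff_sub_mul_invMulSubX (N : ℕ) {m : ℕ} (hm : m ≠ 0) :
    (partialFracCoeff K (N + 1) m - partialFracCoeff K N m) * invMulSubX K m =
      partialFracCoeff K (N + 1) m * invMulSubX K (N + 1) := by
  have h := ratioProd_add_one_left (K := K) N m
  have hm := mul_sub_X_mul_invMulSubX (K := K) hm
  have hN := mul_sub_X_mul_invMulSubX (K := K) N.succ_ne_zero
  push_cast at hN
  simp only [partialFracCoeff]
  generalize (-1) ^ (m + 1) * (2 - C (m : K)⁻¹ * X) * harmonicProd K m = A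
  linear_combination (-A * invMulSubX K m * invMulSubX K (N + 1)) * h +
    (A * ratioProd K (N + 1) m * invMulSubX K (N + 1)) * hm -
    (A * ratioProd K (N + 1) m - A * ratioProd K N m) * invMulSubX K m * hN

theorem sum_partialFracCoeff {N : ℕ} (hN : N ≠ 0) :
    ∑ k ∈ range N, partialFracCoeff K N (k + 1) = geom (N : K)⁻¹ := by
  let D (k : ℕ) : K⟦X⟧ := (-1) ^ k * (N - k) * harmonicProd K k * ratioProd K N k
  have hD (k : ℕ) : (N - (X : K⟦X⟧)) * partialFracCoeff K N (k + 1) = D k - D (k + 1) := by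
    have hH := harmonicProd_succ (K := K) k
    have hR := ratioProd_succ (K := K) N k
    have hinv := natCast_mul_C_inv (K := K) k.succ_ne_zero
    simp only [D, partialFracCoeff]
    push_cast at hinv ⊢
    linear_combination (-1) ^ k * (harmonicProd K k * hR +
      (N + 1 + k - X) * ratioProd K N (k + 1) * C ((k : K) + 1)⁻¹ * hH +
      ((N + 1 + k - X) * ratioProd K N (k + 1) * (harmonicProd K k - harmonicProd K (k + 1)) +
        X * harmonicProd K (k + 1) * ratioProd K N (k + 1)) * hinv)
  refine mul_left_cancel₀ (natCast_sub_X_ne_zero hN) ?_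
  rw [mul_sum, sum_congr rfl fun k _ => hD k, sum_range_sub', natCast_sub_X_mul_geom hN]
  simp [D, harmonicProd, ratioProd]

/-- The generating function of the star sums truncated at `N`, in partial fractions. -/
noncomputable def partialFracSum (K : Type*) [Field K] (s N : ℕ) : K⟦X⟧ :=
  ∑ k ∈ range N, partialFracCoeff K N (k + 1) * invMulSubX K (k + 1) ^ s

theorem partialFracSum_add_one (s N : ℕ) :
    partialFracSum K (s + 1) (N + 1) =
      partialFracSum K (s + 1) N + partialFracSum K s (N + 1) * invMulSubX K (N + 1) := by
  have hlast : partialFracSum K (s + 1) N =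
      ∑ k ∈ range (N + 1), partialFracCoeff K N (k + 1) * invMulSubX K (k + 1) ^ (s + 1) := by
    simp [partialFracSum, sum_range_succ _ N, partialFracCoeff, ratioProd_eq_zero]
  rw [hlast, partialFracSum, partialFracSum, sum_mul, ← sum_add_distrib]
  refine sum_congr rfl fun k _ => ?_
  linear_combination invMulSubX K (k + 1) ^ s *
    partialFracCoeff_sub_mul_invMulSubX (K := K) N k.succ_ne_zero

theorem partialFracSum_zero_left {N : ℕ} (hN : N ≠ 0) : partialFracSum K 0 N = geom (N : K)⁻¹ := by
  simp [partialFracSum, sum_partialFracCoeff hN]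

theorem partialFracSum_succ_left (s N : ℕ) :
    partialFracSum K (s + 1) N =
      ∑ M ∈ range N, partialFracSum K s (M + 1) * invMulSubX K (M + 1) := by
  induction N with
  | zero => simp [partialFracSum]
  | succ N ih => rw [partialFracSum_add_one, sum_range_succ, ih]

theorem partialFracSum_eq_starSum (s N : ℕ) :
    partialFracSum K (s + 1) N =
      starSum (fun (j : Fin (s + 1)) m =>
        (if j = 0 then geom (m : K)⁻¹ else 1) * invMulSubX K m) N := by
  rw [partialFracSum_succ_left, starSum_eq_sum_range]
  induction s generalizing N with
  | zero => simp [partialFracSum_zero_left]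
  | succ s ih =>
    refine sum_congr rfl fun M _ => ?_
    rw [partialFracSum_succ_left, ih, ← starSum_eq_sum_range, if_neg (Fin.last_pos.ne'), one_mul]
    congr 2
    ext j m
    simp [Fin.init, Fin.castSucc_eq_zero_iff]

theorem coeff_partialFracSum (s N r : ℕ) :
    coeff r (partialFracSum K (s + 1) N) =
      ∑ ρ ∈ piAntidiag univ r, ((ρ 0 : K) + 1) *
        starSum (fun (j : Fin (s + 1)) m => ((m : K) ^ (ρ j + 2))⁻¹) N := by
  have hcoeff (a : ℕ) (j : Fin (s + 1)) (m : ℕ) :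
      coeff a ((if j = 0 then geom (m : K)⁻¹ else 1) * invMulSubX K m) =
        (if j = 0 then (a : K) + 1 else 1) * ((m : K) ^ (a + 2))⁻¹ := by
    have hsq := coeff_geom_pow (m : K)⁻¹ 2 a
    rw [pow_two, Nat.multichoose_two] at hsq
    split_ifs
    · rw [invMulSubX, mul_left_comm, coeff_C_mul, hsq]
      push_cast
      ring
    · rw [invMulSubX, one_mul, coeff_C_mul, coeff_geom]
      ring
  rw [partialFracSum_eq_starSum, coeff_starSum]
  refine sum_congr rfl fun ρ _ => ?_
  simp only [hcoeff, starSum_mul_left, prod_ite_eq', mem_univ, if_true]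

end PartialFractions

/-- The power series `q` majorizes `p`: each coefficient of `q` bounds the absolute value of the
corresponding coefficient of `p`. -/
def CoeffLE (p q : ℝ⟦X⟧) : Prop :=
  ∀ i, |coeff i p| ≤ coeff i q

theorem CoeffLE.trans {p q q' : ℝ⟦X⟧} (h : CoeffLE p q) (h' : CoeffLE q q') : CoeffLE p q' :=
  fun i => (h i).trans ((le_abs_self _).trans (h' i))

theorem CoeffLE.add {p q p' q' : ℝ⟦X⟧} (h : CoeffLE p q) (h' : CoeffLE p' q') :
    CoeffLE (p + p') (q + q') := fun i => by
  simpa only [map_add] using (abs_add_le _ _).trans (add_le_add (h i) (h' i))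

theorem CoeffLE.mul {p q p' q' : ℝ⟦X⟧} (h : CoeffLE p q) (h' : CoeffLE p' q') :
    CoeffLE (p * p') (q * q') := by
  intro i
  rw [coeff_mul, coeff_mul]
  refine (abs_sum_le_sum_abs _ _).trans (sum_le_sum fun x _ => ?_)
  rw [abs_mul]
  exact mul_le_mul (h _) (h' _) (abs_nonneg _) ((abs_nonneg _).trans (h _))

theorem coeffLE_C {a b : ℝ} (h : |a| ≤ b) : CoeffLE (C a) (C b) := by
  intro i
  rw [coeff_C, coeff_C]
  split_ifs
  · exact h
  · exact abs_zero.le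

theorem CoeffLE.prod {ι : Type*} {s : Finset ι} {p q : ι → ℝ⟦X⟧}
    (h : ∀ i, CoeffLE (p i) (q i)) : CoeffLE (∏ i ∈ s, p i) (∏ i ∈ s, q i) :=
  prod_hom_rel (by simpa using coeffLE_C abs_one.le) fun i _ _ => (h i).mul

theorem CoeffLE.pow {p q : ℝ⟦X⟧} (h : CoeffLE p q) (n : ℕ) : CoeffLE (p ^ n) (q ^ n) := by
  simpa using CoeffLE.prod (s := range n) fun _ => h

theorem coeffLE_geom {a b : ℝ} (h : |a| ≤ b) : CoeffLE (geom a) (geom b) := fun i => by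
  simpa only [coeff_geom, abs_pow] using pow_le_pow_left₀ (abs_nonneg a) h i

theorem coeffLE_C_mul_geom {c a b : ℝ} (hc : |c| ≤ 1) (h : |a| ≤ b) :
    CoeffLE (C c * geom a) (geom b) := by
  simpa only [map_one, one_mul] using (coeffLE_C hc).mul (coeffLE_geom h)

theorem ratioProd_coeffLE (N m : ℕ) : CoeffLE (ratioProd ℝ N m) (harmonicProd ℝ m) := by
  refine CoeffLE.prod fun j => coeffLE_C_mul_geom ?_ ?_
  · have hdiff : |(N : ℝ) - j| ≤ ((N + 1 + j : ℕ) : ℝ) := by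
      push_cast
      rw [abs_le]
      constructor <;> linarith [N.cast_nonneg (α := ℝ), j.cast_nonneg (α := ℝ)]
    rw [← div_eq_mul_inv, abs_div, Nat.abs_cast]
    exact div_le_one_of_le₀ hdiff (Nat.cast_nonneg _)
  · rw [abs_inv, Nat.abs_cast]
    exact inv_anti₀ (by positivity) (by exact_mod_cast (by omega : j + 1 ≤ N + 1 + j))

theorem ratCast_harmonic (m : ℕ) : (harmonic m : ℝ) = ∑ j ∈ Icc 1 m, (j : ℝ)⁻¹ := by
  rw [harmonic_eq_sum_Icc]
  push_cast
  rfl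

theorem ratCast_harmonic_nonneg (m : ℕ) : 0 ≤ (harmonic m : ℝ) := by
  rw [ratCast_harmonic]
  positivity

theorem harmonicProd_coeffLE (m : ℕ) : CoeffLE (harmonicProd ℝ m) (geom (harmonic m : ℝ)) := by
  intro i
  have hnonneg (_ : Fin i) (j : ℕ) : (0 : ℝ) ≤ (j : ℝ)⁻¹ := by positivity
  rw [coeff_harmonicProd, abs_of_nonneg (starSum_nonneg hnonneg m), coeff_geom]
  simpa [ratCast_harmonic] using starSum_le_prod_sum hnonneg m

/-- A majorant, with summable coefficients, of the terms of the partial fraction expansion. -/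
noncomputable def partialFracMajorant (s m : ℕ) : ℝ⟦X⟧ :=
  C ((m : ℝ)⁻¹ ^ 2) * (geom (harmonic m : ℝ) ^ s + geom (harmonic m : ℝ) ^ (s + 1))

theorem partialFracLimit_coeffLE (s : ℕ) {m : ℕ} (hm : m ≠ 0) :
    CoeffLE (partialFracLimit ℝ (s + 1) m) (partialFracMajorant (s + 1) m) := by
  have hinv : (m : ℝ)⁻¹ ≤ 1 := Nat.cast_inv_le_one m
  have hharm : |(m : ℝ)⁻¹| ≤ harmonic m := by
    rw [abs_of_nonneg (by positivity), ratCast_harmonic]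
    exact single_le_sum (f := fun j : ℕ => (j : ℝ)⁻¹) (fun _ _ => by positivity)
      (mem_Icc.2 ⟨Nat.one_le_iff_ne_zero.2 hm, le_rfl⟩)
  have hsign : CoeffLE ((-1) ^ (m + 1)) 1 := by
    simpa using coeffLE_C (abs_neg_one_pow (m + 1)).le
  have hpow : CoeffLE (C ((m : ℝ)⁻¹ ^ (2 * (s + 1)))) (C ((m : ℝ)⁻¹ ^ 2)) :=
    coeffLE_C <| by
      rw [abs_of_nonneg (by positivity)]
      exact pow_le_pow_of_le_one (by positivity) hinv (by omega)
  have hgeom := coeffLE_geom hharm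
  rw [partialFracLimit, two_sub_mul_invMulSubX_pow]
  convert (hsign.mul (hpow.mul ((hgeom.pow s).add (hgeom.pow (s + 1))))).mul
    (harmonicProd_coeffLE m) using 1
  rw [partialFracMajorant]
  ring

theorem partialFracCoeff_mul_invMulSubX_pow_coeffLE (s N : ℕ) {m : ℕ} (hm : m ≠ 0) :
    CoeffLE (partialFracCoeff ℝ N m * invMulSubX ℝ m ^ (s + 1))
      (partialFracMajorant (s + 2) m) := by
  rw [partialFracCoeff_mul_invMulSubX_pow]
  convert (partialFracLimit_coeffLE s hm).mul
    ((ratioProd_coeffLE N m).trans (harmonicProd_coeffLE m)) using 1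
  rw [partialFracMajorant, partialFracMajorant]
  ring

theorem isBigO_harmonic_log :
    (fun m : ℕ => (harmonic m : ℝ)) =O[atTop] fun m : ℕ => Real.log m := by
  have h := (Real.tendsto_harmonic_sub_log.isBigO_one ℝ).trans
    (Real.isLittleO_const_log_atTop.isBigO.comp_tendsto tendsto_natCast_atTop_atTop)
  exact (h.add (isBigO_refl _ atTop)).congr_left fun m => sub_add_cancel _ (Real.log m)

theorem summable_harmonic_pow_mul_inv_sq (r : ℕ) :
    Summable fun m : ℕ => (harmonic m : ℝ) ^ r * (m : ℝ)⁻¹ ^ 2 := by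
  have hsqrt : (fun m : ℕ => (harmonic m : ℝ) ^ r) =O[atTop] fun m : ℕ => (m : ℝ) ^ (1 / 2 : ℝ) :=
    (isBigO_harmonic_log.pow r).trans <| by
      simpa [Function.comp_def] using
        (isLittleO_log_rpow_rpow_atTop r one_half_pos).isBigO.comp_tendsto
          tendsto_natCast_atTop_atTop
  refine summable_of_isBigO_nat (Real.summable_nat_rpow.2 (by norm_num : (-3 / 2 : ℝ) < -1))
    ((hsqrt.mul (isBigO_refl (fun m : ℕ => (m : ℝ)⁻¹ ^ 2) atTop)).congr' .rfl ?_)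
  filter_upwards [eventually_gt_atTop 0] with m hm
  have hm' : (0 : ℝ) < m := Nat.cast_pos.2 hm
  rw [inv_pow, ← Real.rpow_natCast, ← Real.rpow_neg hm'.le, ← Real.rpow_add hm']
  norm_num

theorem summable_coeff_partialFracMajorant (r s : ℕ) :
    Summable fun m => coeff r (partialFracMajorant s m) :=
  ((summable_harmonic_pow_mul_inv_sq r).mul_left
    (s.multichoose r + (s + 1).multichoose r : ℝ)).congr fun m => by
      rw [partialFracMajorant, coeff_C_mul, map_add, coeff_geom_pow, coeff_geom_pow]
      ring

theorem summable_coeff_partialFracLimit (r s : ℕ) :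
    Summable fun k => coeff r (partialFracLimit ℝ (s + 1) (k + 1)) :=
  ((summable_nat_add_iff 1).2 (summable_coeff_partialFracMajorant r (s + 1))).of_norm_bounded
    fun k => partialFracLimit_coeffLE s k.succ_ne_zero r

section Limits

open scoped PowerSeries.WithPiTopology

theorem tendsto_ratioProd (m : ℕ) : Tendsto (fun N => ratioProd ℝ N m) atTop (𝓝 1) := by
  rw [← prod_const_one (s := range m)]
  refine tendsto_finsetProd _ fun j _ => ?_
  have hratio : Tendsto (fun N : ℕ => ((N : ℝ) - j) * ((N + 1 + j : ℕ) : ℝ)⁻¹) atTop (𝓝 1) := by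
    have h := tendsto_add_mul_div_add_mul_atTop_nhds (-j : ℝ) (1 + j) 1 (one_ne_zero (α := ℝ))
    rw [div_one] at h
    refine h.congr fun N => ?_
    push_cast
    ring
  have hinv : Tendsto (fun N : ℕ => ((N + 1 + j : ℕ) : ℝ)⁻¹) atTop (𝓝 0) := by
    simpa only [add_assoc] using
      (tendsto_add_atTop_iff_nat (1 + j)).2 (tendsto_inv_atTop_nhds_zero_nat (𝕜 := ℝ))
  rw [PowerSeries.WithPiTopology.tendsto_iff_coeff_tendsto]
  intro i
  have hlim : (coeff i (1 : ℝ⟦X⟧) : ℝ) = 1 * 0 ^ i := by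
    simp [coeff_one, zero_pow_eq]
  simp only [coeff_C_mul, coeff_geom]
  rw [hlim]
  exact hratio.mul (hinv.pow i)

theorem tendsto_partialFracCoeff_mul_invMulSubX_pow (s m : ℕ) :
    Tendsto (fun N => partialFracCoeff ℝ N m * invMulSubX ℝ m ^ s) atTop
      (𝓝 (partialFracLimit ℝ s m)) := by
  simpa only [partialFracCoeff_mul_invMulSubX_pow, mul_one] using
    (tendsto_ratioProd m).const_mul (partialFracLimit ℝ s m)

theorem tendsto_coeff_partialFracSum (s r : ℕ) :
    Tendsto (fun N => coeff r (partialFracSum ℝ (s + 1) N)) atTop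
      (𝓝 (∑' k, coeff r (partialFracLimit ℝ (s + 1) (k + 1)))) := by
  have hsum (N : ℕ) : coeff r (partialFracSum ℝ (s + 1) N) =
      ∑' k, coeff r (partialFracCoeff ℝ N (k + 1) * invMulSubX ℝ (k + 1) ^ (s + 1)) := by
    rw [tsum_eq_sum (s := range N), partialFracSum, map_sum]
    intro k hk
    have hNk : N < k + 1 := by simpa [Nat.lt_succ_iff] using hk
    simp [partialFracCoeff, ratioProd_eq_zero hNk]
  simp only [hsum]
  refine tendsto_tsum_of_dominated_convergence
    ((summable_nat_add_iff 1).2 (summable_coeff_partialFracMajorant r (s + 2))) (fun k => ?_)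
    (.of_forall fun N k => partialFracCoeff_mul_invMulSubX_pow_coeffLE s N k.succ_ne_zero r)
  exact (PowerSeries.WithPiTopology.tendsto_iff_coeff_tendsto _ _ _ _).1
    (tendsto_partialFracCoeff_mul_invMulSubX_pow (s + 1) (k + 1)) r

end Limits

section MplStar

open Classical in
/-- `starTuples n N` as a finite set of indices of the infinite star sums. -/
noncomputable def starBox (n N : ℕ) : Finset (StarIndex n) :=
  (starTuples n N).subtype fun m => Monotone m ∧ ∀ j, 1 ≤ m j

theorem mem_starBox {n N : ℕ} {m : StarIndex n} : m ∈ starBox n N ↔ ∀ j, m.1 j ≤ N :=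
  mem_subtype.trans (by simp [mem_starTuples, m.2.1, m.2.2])

theorem sum_starBox {n : ℕ} (f : (Fin n → ℕ) → ℝ) (N : ℕ) :
    ∑ m ∈ starBox n N, f m.1 = ∑ m ∈ starTuples n N, f m :=
  sum_subtype_of_mem f fun _ hm =>
    ⟨(mem_starTuples.1 hm).2, fun j => ((mem_starTuples.1 hm).1 j).1⟩

theorem tendsto_starBox_atTop (n : ℕ) : Tendsto (starBox n) atTop atTop :=
  tendsto_atTop_finset_of_monotone
    (fun _ _ h _ hm => mem_starBox.2 fun j => (mem_starBox.1 hm j).trans h)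
    fun m => ⟨∑ j, m.1 j, mem_starBox.2 fun j => single_le_sum (by simp) (mem_univ j)⟩

/-- The contribution of the entry `m_j = m` to the summand `mplStarTerm z hn k`. -/
noncomputable def mplFactor {n : ℕ} (z : ℝ) (k : Fin (n + 1) → ℕ) (j : Fin (n + 1)) (m : ℕ) : ℝ :=
  (if j = Fin.last n then z ^ (m - 1) else 1) * ((m : ℝ) ^ k j)⁻¹

variable {n : ℕ} {z : ℝ} {k : Fin (n + 1) → ℕ}

theorem mplFactor_one (k : Fin (n + 1) → ℕ) :
    mplFactor 1 k = fun j (m : ℕ) => ((m : ℝ) ^ k j)⁻¹ := by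
  ext j m
  simp [mplFactor]

theorem init_mplFactor (z : ℝ) (k : Fin (n + 1) → ℕ) :
    Fin.init (mplFactor z k) = fun j (m : ℕ) => ((m : ℝ) ^ Fin.init k j)⁻¹ := by
  ext j m
  simp [mplFactor, Fin.init, (Fin.castSucc_lt_last j).ne]

theorem mplFactor_last (z : ℝ) (k : Fin (n + 1) → ℕ) (m : ℕ) :
    mplFactor z k (Fin.last n) m = z ^ (m - 1) * ((m : ℝ) ^ k (Fin.last n))⁻¹ := by
  simp [mplFactor]

theorem mplStarTerm_eq_prod (hn : 1 ≤ n + 1) (m : StarIndex (n + 1)) :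
    mplStarTerm z hn k m = ∏ j, mplFactor z k j (m.1 j) := by
  simp only [mplFactor, prod_mul_distrib, prod_ite_eq', mem_univ, if_true, prod_inv_distrib]
  rfl

theorem sum_mplStarTerm (hn : 1 ≤ n + 1) (N : ℕ) :
    ∑ m ∈ starBox (n + 1) N, mplStarTerm z hn k m = starSum (mplFactor z k) N := by
  simp only [mplStarTerm_eq_prod, sum_starBox fun m => ∏ j, mplFactor z k j (m j), starSum]

theorem starSum_mplFactor_one_le (hk : ∀ j, 1 ≤ k j) (hlast : 2 ≤ k (Fin.last n)) (N : ℕ) :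
    starSum (mplFactor 1 k) N ≤
      ∑ M ∈ range N, (harmonic (M + 1) : ℝ) ^ n * ((M + 1 : ℕ) : ℝ)⁻¹ ^ 2 := by
  have hinv {m a b : ℕ} (hab : a ≤ b) : ((m : ℝ) ^ b)⁻¹ ≤ (m : ℝ)⁻¹ ^ a := by
    rw [← inv_pow]
    exact pow_le_pow_of_le_one (by positivity) (Nat.cast_inv_le_one m) hab
  rw [starSum_eq_sum_range]
  refine sum_le_sum fun M _ => ?_
  rw [init_mplFactor, mplFactor_last, one_pow, one_mul]
  refine mul_le_mul ?_ (hinv hlast) (by positivity)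
    (pow_nonneg (ratCast_harmonic_nonneg _) _)
  calc starSum (fun (j : Fin n) (m : ℕ) => ((m : ℝ) ^ Fin.init k j)⁻¹) (M + 1)
      ≤ ∏ j, ∑ m ∈ Icc 1 (M + 1), ((m : ℝ) ^ Fin.init k j)⁻¹ :=
        starSum_le_prod_sum (fun _ _ => by positivity) _
    _ ≤ ∏ _j : Fin n, ∑ m ∈ Icc 1 (M + 1), (m : ℝ)⁻¹ := by
        refine prod_le_prod (fun _ _ => by positivity) fun j _ => sum_le_sum fun m _ => ?_
        simpa only [pow_one, Fin.init] using hinv (hk j.castSucc)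
    _ = (harmonic (M + 1) : ℝ) ^ n := by
        rw [ratCast_harmonic, prod_const, card_univ, Fintype.card_fin]

theorem abs_mplStarTerm_le (hz : |z| ≤ 1) (hn : 1 ≤ n + 1) (m : StarIndex (n + 1)) :
    |mplStarTerm z hn k m| ≤ mplStarTerm 1 hn k m := by
  rw [mplStarTerm, mplStarTerm, abs_div, abs_pow, one_pow,
    abs_of_nonneg (by positivity : 0 ≤ ∏ j, (m.1 j : ℝ) ^ k j)]
  gcongr
  exact pow_le_one₀ (abs_nonneg z) hz

theorem summable_mplStarTerm (hz : |z| ≤ 1) (hn : 1 ≤ n + 1) (hk : ∀ j, 1 ≤ k j)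
    (hlast : 2 ≤ k (Fin.last n)) : Summable (mplStarTerm z hn k) := by
  have hnonneg (m : StarIndex (n + 1)) : 0 ≤ mplStarTerm 1 hn k m :=
    (abs_nonneg _).trans (abs_mplStarTerm_le abs_one.le hn m)
  have hmajorant := (summable_nat_add_iff 1).2 (summable_harmonic_pow_mul_inv_sq n)
  refine Summable.of_norm_bounded (summable_of_sum_le
    (c := ∑' M : ℕ, (harmonic (M + 1) : ℝ) ^ n * ((M + 1 : ℕ) : ℝ)⁻¹ ^ 2)
    hnonneg fun u => ?_) (abs_mplStarTerm_le hz hn)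
  obtain ⟨N, hN⟩ := ((tendsto_starBox_atTop (n + 1)).eventually_ge_atTop u).exists
  calc ∑ m ∈ u, mplStarTerm 1 hn k m
      ≤ ∑ m ∈ starBox (n + 1) N, mplStarTerm 1 hn k m :=
        sum_le_sum_of_subset_of_nonneg hN fun m _ _ => hnonneg m
    _ = starSum (mplFactor 1 k) N := sum_mplStarTerm hn N
    _ ≤ _ := starSum_mplFactor_one_le hk hlast N
    _ ≤ _ := hmajorant.sum_le_tsum _ fun M _ =>
        mul_nonneg (pow_nonneg (ratCast_harmonic_nonneg _) _) (by positivity)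

theorem tendsto_starSum_mplFactor (hz : |z| ≤ 1) (hn : 1 ≤ n + 1) (hk : ∀ j, 1 ≤ k j)
    (hlast : 2 ≤ k (Fin.last n)) :
    Tendsto (starSum (mplFactor z k)) atTop (𝓝 (mplStar z hn k)) :=
  ((summable_mplStarTerm hz hn hk hlast).hasSum.comp (tendsto_starBox_atTop (n + 1))).congr
    (sum_mplStarTerm hn)

end MplStar

theorem one_le_onesThen (a : ℕ) {b : ℕ} (hb : 1 ≤ b) (j : Fin (a + 1)) :
    1 ≤ onesThen a b j := by
  refine Fin.lastCases ?_ (fun j => ?_) j <;> simp [onesThen, hb]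

theorem onesThen_last (a b : ℕ) : onesThen a b (Fin.last a) = b :=
  Fin.snoc_last (α := fun _ => ℕ) _ _

theorem starSum_mplFactor_onesThen (z : ℝ) (a b N : ℕ) :
    starSum (mplFactor z (onesThen a b)) N =
      ∑ M ∈ range N, z ^ M * (starSum (fun (_ : Fin a) j => (j : ℝ)⁻¹) (M + 1) *
        ((M + 1 : ℕ) : ℝ)⁻¹ ^ b) := by
  have hinit : Fin.init (onesThen a b) = fun _ => 1 := Fin.init_snoc (α := fun _ => ℕ) _ _
  rw [starSum_eq_sum_range]
  refine sum_congr rfl fun M _ => ?_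
  rw [init_mplFactor, mplFactor_last, hinit, onesThen_last, Nat.add_sub_cancel]
  simp only [pow_one, inv_pow]
  ring

theorem sum_coeff_partialFracLimit (r s N : ℕ) :
    ∑ k ∈ range N, coeff r (partialFracLimit ℝ (s + 1) (k + 1)) =
      ∑ i ∈ range (r + 1), ((s.multichoose i : ℝ) + (s + 1).multichoose i) *
        starSum (mplFactor (-1) (onesThen (r - i) (2 * (s + 1) + i))) N := by
  have hsign (k : ℕ) : (-1 : ℝ) ^ (k + 1 + 1) = (-1) ^ k := by ring
  simp only [starSum_mplFactor_onesThen, coeff_partialFracLimit, mul_sum, hsign]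
  exact sum_comm

theorem tsum_coeff_partialFracLimit (r s : ℕ) :
    ∑' k, coeff r (partialFracLimit ℝ (s + 1) (k + 1)) =
      ∑ i ∈ range (r + 1), ((s.multichoose i : ℝ) + (s + 1).multichoose i) *
        zetaStarMinus (Nat.le_add_left 1 (r - i)) (onesThen (r - i) (2 * (s + 1) + i)) := by
  refine tendsto_nhds_unique (summable_coeff_partialFracLimit r s).hasSum.tendsto_sum_nat ?_
  simp only [sum_coeff_partialFracLimit]
  exact tendsto_finsetSum _ fun i _ => (tendsto_starSum_mplFactor (by simp) _
    (one_le_onesThen _ (by omega)) (by rw [onesThen_last]; omega)).const_mul _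

theorem tendsto_coeff_partialFracSum_zetaStar (r s : ℕ) (hs : 1 ≤ s + 1) :
    Tendsto (fun N => coeff r (partialFracSum ℝ (s + 1) N)) atTop
      (𝓝 (∑ ρ ∈ piAntidiag univ r, ((ρ ⟨0, hs⟩ : ℝ) + 1) * zetaStar hs fun j => ρ j + 2)) := by
  simp only [coeff_partialFracSum, ← mplFactor_one]
  refine tendsto_finsetSum _ fun ρ _ => Tendsto.const_mul _ ?_
  exact tendsto_starSum_mplFactor abs_one.le hs (fun j => by omega) (by omega)

theorem ringChoose_eq_multichoose (d i : ℕ) :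
    Ring.choose ((d : ℤ) - 1 + i) i = (d.multichoose i : ℤ) := by
  have hd : (d : ℤ) - 1 + i - i + 1 = d := by ring
  rw [Ring.choose, hd, Nat.multichoose_eq]
  rfl

theorem theorem2 (r s : ℕ) (hs : 1 ≤ s) :
    (∀ i ∈ Finset.range (r + 1),
      Summable (mplStarTerm (-1) (Nat.le_add_left 1 (r - i)) (onesThen (r - i) (2 * s + i)))) ∧
    (∀ ρ ∈ Finset.piAntidiag (Finset.univ : Finset (Fin s)) r,
      Summable (mplStarTerm 1 hs (fun j => ρ j + 2))) ∧
    ∑ i ∈ Finset.range (r + 1),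
        ((Ring.choose ((s : ℤ) - 2 + i) i + Ring.choose ((s : ℤ) - 1 + i) i : ℤ) : ℝ) *
          zetaStarMinus (Nat.le_add_left 1 (r - i)) (onesThen (r - i) (2 * s + i)) =
      ∑ ρ ∈ Finset.piAntidiag (Finset.univ : Finset (Fin s)) r,
        ((ρ ⟨0, hs⟩ : ℝ) + 1) * zetaStar hs (fun j => ρ j + 2) := by
  obtain ⟨s, rfl⟩ := Nat.exists_eq_add_of_le' hs
  have hweight (i : ℕ) : ((Ring.choose (((s + 1 : ℕ) : ℤ) - 2 + i) i +
      Ring.choose (((s + 1 : ℕ) : ℤ) - 1 + i) i : ℤ) : ℝ) =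
        s.multichoose i + (s + 1).multichoose i := by
    have hshift : ((s + 1 : ℕ) : ℤ) - 2 + i = s - 1 + i := by omega
    rw [hshift, ringChoose_eq_multichoose, ringChoose_eq_multichoose]
    push_cast
    rfl
  refine ⟨fun i _ => ?_, fun ρ _ => ?_, ?_⟩
  · exact summable_mplStarTerm (by simp) _ (one_le_onesThen _ (by omega))
      (by rw [onesThen_last]; omega)
  · exact summable_mplStarTerm abs_one.le hs (fun j => by omega) (by omega)
  · simp only [hweight]
    rw [← tsum_coeff_partialFracLimit]
    exact tendsto_nhds_unique (tendsto_coeff_partialFracSum s r)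
      (tendsto_coeff_partialFracSum_zetaStar r s hs)
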